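/- Let $d\in\mathbb{N}$ and let $P=(p_{ij})_{0\le i,j\le d-1}$ be a real $d\times d$ matrix with $p_{ij}\ge 0$ and $\sum_{i,j}p_{ij}=1$. Let $X=\sum_{k=0}^{d-1}|k+1\rangle\langle k|$ (addition modulo $d$) and $Z=\sum_{k=0}^{d-1}\omega^k|k\rangle\langle k|$ with $\omega=e^{2\pi i/d}$ be the shift and clock matrices, put $U_{ij}=X^iZ^j$, and let $$\Phi_P:M_d(\mathbb{C})\to M_d(\mathbb{C}),\qquad \Phi_P(Y)=\sum_{0\le i,j\le d-1}p_{ij}\,U_{ij}\,Y\,U_{ij}^\dagger$$ be the generalized Pauli (Weyl) channel associated with $P$. Two linear maps $\Phi:M_{d}(\mathbb{C})\to M_{d_{\rm out}}(\mathbb{C})$ and $\Phi_c:M_{d}(\mathbb{C})\to M_{d_{\rm env}}(\mathbb{C})$ are called complementary channels if there is an isometry $V:\mathbb{C}^{d}\to\mathbb{C}^{d_{\rm out}}\otimes\mathbb{C}^{d_{\rm env}}$ with $\Phi(Y)=\operatorname{Tr}_{\rm env}(VYV^\dagger)$ and $\Phi_c(Y)=\operatorname{Tr}_{\rm out}(VYV^\dagger)$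 for all $Y$. For a channel $\Phi$ and a state $\rho$ (a positive semidefinite matrix of trace one) on its input space let $I_c(\rho;\Phi)=S(\Phi(\rho))-S(\Phi_c(\rho))$, where $S(\sigma)=-\operatorname{Tr}(\sigma\log\sigma)$ and $\Phi_c$ is any channel complementary to $\Phi$ (the value does not depend on which one), let $Q^{(1)}(\Phi)=\max_\rho I_c(\rho;\Phi)$, and let the quantum capacity of $\Phi$ be $$Q(\Phi)=\lim_{n\to\infty}\frac{Q^{(1)}(\Phi^{\otimes n})}{n}.$$ **Theorem.** Suppose that $P$ has at least $d+1$ nonzero entries, and that either every row of $P$ is nonzero or every column of $P$ is nonzero. Then for every $m\in\mathbb{N}$ and every channel $\Psi:M_d(\mathbb{C})\to M_m(\mathbb{C})$ complementary to $\Phi_P$, the quantum capacity of $\Psi$ is positive: the limit defining $Q(\Psi)$ exists and $Q(\Psi)>0$. -/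

import Mathlib

open scoped Matrix ComplexOrder

namespace QChannel

noncomputable section

/-! Quantum states and the von Neumann entropy -/

/-- A quantum state (density matrix): a positive semidefinite matrix of unit trace. -/
def IsState {n : Type*} [Fintype n] (ρ : Matrix n n ℂ) : Prop :=
  ρ.PosSemidef ∧ ρ.trace = 1

/-- The von Neumann entropy `S(ρ) = -Tr (ρ log ρ)` (natural logarithm).  The logarithm of a
Hermitian matrix is taken with the functional calculus; as `0 * log 0 = 0`, zero eigenvalues do
not contribute. -/
def entropy {n : Type*} [Fintype n] [DecidableEq n] (ρ : Matrix n n ℂ) : ℝ :=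
  -(ρ * cfc Real.log ρ).trace.re

/-- The entropy in terms of the eigenvalues: `S(ρ) = ∑ -λ log λ`. -/
theorem entropy_eq_sum {n : Type*} [Fintype n] [DecidableEq n] {ρ : Matrix n n ℂ}
    (h : ρ.IsHermitian) : entropy ρ = ∑ i, Real.negMulLog (h.eigenvalues i) := by
  have key : ρ * cfc Real.log ρ = Unitary.conjStarAlgAut ℂ _ h.eigenvectorUnitary
      (Matrix.diagonal fun i => ((h.eigenvalues i * Real.log (h.eigenvalues i) : ℝ) : ℂ)) := by
    rw [h.cfc_eq, Matrix.IsHermitian.cfc]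
    nth_rewrite 1 [h.spectral_theorem]
    rw [← map_mul, Matrix.diagonal_mul_diagonal]
    simp
  rw [entropy, key, Unitary.conjStarAlgAut_apply, Matrix.trace_mul_comm, ← mul_assoc]
  simp [Matrix.trace_diagonal, Real.negMulLog]

theorem entropy_eq_roots {n : Type*} [Fintype n] [DecidableEq n] {ρ : Matrix n n ℂ}
    (h : ρ.IsHermitian) :
    entropy ρ = (ρ.charpoly.roots.map fun z => Real.negMulLog z.re).sum := by
  rw [entropy_eq_sum h, h.roots_charpoly_eq_eigenvalues, Multiset.map_map]
  rfl

/-- `A Aᴴ` and `Aᴴ A` have the same entropy. -/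
theorem entropy_mul_conjTranspose_comm {m n : Type*} [Fintype m] [DecidableEq m] [Fintype n]
    [DecidableEq n] (A : Matrix m n ℂ) : entropy (A * Aᴴ) = entropy (Aᴴ * A) := by
  rw [entropy_eq_roots (Matrix.isHermitian_mul_conjTranspose_self A),
    entropy_eq_roots (Matrix.isHermitian_conjTranspose_mul_self A)]
  have h := congrArg Polynomial.roots (Matrix.charpoly_mul_comm' A Aᴴ)
  rw [Polynomial.roots_mul (mul_ne_zero (pow_ne_zero _ Polynomial.X_ne_zero)
      (Matrix.charpoly_monic _).ne_zero),
    Polynomial.roots_mul (mul_ne_zero (pow_ne_zero _ Polynomial.X_ne_zero)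
      (Matrix.charpoly_monic _).ne_zero), Polynomial.roots_X_pow, Polynomial.roots_X_pow] at h
  have h' := congrArg (fun s => (Multiset.map (fun z : ℂ => Real.negMulLog z.re) s).sum) h
  simpa [Multiset.map_nsmul, Multiset.sum_nsmul] using h'

/-! Complementary channels -/

/-- The partial trace `Tr_env` over the second tensor factor. -/
def traceEnv {o e : Type*} [Fintype e] (M : Matrix (o × e) (o × e) ℂ) : Matrix o o ℂ :=
  Matrix.of fun a b => ∑ x, M (a, x) (b, x)

/-- The partial trace `Tr_out` over the first tensor factor. -/
def traceOut {o e : Type*} [Fintype o] (M : Matrix (o × e) (o × e) ℂ) : Matrix e e ℂ :=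
  Matrix.of fun x y => ∑ a, M (a, x) (a, y)

/-- Two maps `Φ` and `Φc` with the same input space are complementary channels: there is a
(Stinespring) isometry `V` from the input space to `output ⊗ environment` with
`Φ(X) = Tr_env (V X Vᴴ)` and `Φc(X) = Tr_out (V X Vᴴ)` for every `X`.  Maps of this form are
automatically completely positive and trace preserving, i.e. quantum channels. -/
def IsComplementary {d o e : Type*} [Fintype d] [DecidableEq d] [Fintype o] [Fintype e]
    (Φ : Matrix d d ℂ →ₗ[ℂ] Matrix o o ℂ) (Φc : Matrix d d ℂ →ₗ[ℂ] Matrix e e ℂ) : Prop :=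
  ∃ V : Matrix (o × e) d ℂ, Vᴴ * V = 1 ∧
    ∀ X : Matrix d d ℂ, Φ X = traceEnv (V * X * Vᴴ) ∧ Φc X = traceOut (V * X * Vᴴ)

theorem traceOut_conj {d o e : Type*} [Fintype d] [Fintype o] (V : Matrix (o × e) d ℂ)
    (B : Matrix d d ℂ) :
    traceOut (V * (B * Bᴴ) * Vᴴ) =
      (Matrix.of fun (x : e) (p : o × d) => (V * B) (p.1, x) p.2) *
        (Matrix.of fun (x : e) (p : o × d) => (V * B) (p.1, x) p.2)ᴴ := by
  have hV : V * (B * Bᴴ) * Vᴴ = (V * B) * (V * B)ᴴ := by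
    simp [Matrix.conjTranspose_mul, Matrix.mul_assoc]
  ext x y
  rw [hV]
  simp only [traceOut, Matrix.of_apply, Matrix.mul_apply (M := V * B), Matrix.conjTranspose_apply]
  rw [Matrix.mul_apply, Fintype.sum_prod_type]
  rfl

theorem traceEnv_conj {d o e : Type*} [Fintype d] [DecidableEq d] [Fintype e]
    (V : Matrix (o × e) d ℂ) (B : Matrix d d ℂ) (p q : o × d) :
    ((Matrix.of fun (x : e) (p : o × d) => (V * B) (p.1, x) p.2)ᴴ *
        (Matrix.of fun (x : e) (p : o × d) => (V * B) (p.1, x) p.2)) p q =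
      traceEnv (V * (B * Matrix.single q.2 p.2 (1 : ℂ) * Bᴴ) * Vᴴ) q.1 p.1 := by
  have hV : V * (B * Matrix.single q.2 p.2 (1 : ℂ) * Bᴴ) * Vᴴ =
      (V * B) * Matrix.single q.2 p.2 (1 : ℂ) * (V * B)ᴴ := by
    simp only [Matrix.conjTranspose_mul, Matrix.mul_assoc]
  rw [hV]
  generalize V * B = W
  simp only [traceEnv, Matrix.of_apply]
  rw [Matrix.mul_apply]
  refine Finset.sum_congr rfl fun x _ => ?_
  rw [Matrix.mul_apply, Finset.sum_eq_single p.2]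
  · simp [mul_comm]
  · intro k _ hk
    simp [Matrix.mul_single_apply_of_ne _ _ _ _ _ hk]
  · simp

/-- Any two channels complementary to `Φ` produce the same entropy on every state, so that the
coherent information does not depend on the complementary channel that is used. -/
theorem IsComplementary.entropy_eq {d o e₁ e₂ : Type*} [Fintype d] [DecidableEq d] [Fintype o]
    [DecidableEq o] [Fintype e₁] [DecidableEq e₁] [Fintype e₂] [DecidableEq e₂]
    {Φ : Matrix d d ℂ →ₗ[ℂ] Matrix o o ℂ} {Φ₁ : Matrix d d ℂ →ₗ[ℂ] Matrix e₁ e₁ ℂ}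
    {Φ₂ : Matrix d d ℂ →ₗ[ℂ] Matrix e₂ e₂ ℂ} (h₁ : IsComplementary Φ Φ₁)
    (h₂ : IsComplementary Φ Φ₂) {ρ : Matrix d d ℂ} (hρ : ρ.PosSemidef) :
    entropy (Φ₁ ρ) = entropy (Φ₂ ρ) := by
  obtain ⟨V₁, -, hV₁⟩ := h₁
  obtain ⟨V₂, -, hV₂⟩ := h₂
  obtain ⟨B, rfl⟩ : ∃ B : Matrix d d ℂ, ρ = B * Bᴴ := by
    open scoped MatrixOrder in
    obtain ⟨B, hB⟩ := CStarAlgebra.nonneg_iff_eq_star_mul_self.mp hρ.nonneg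
    exact ⟨Bᴴ, by simpa [Matrix.star_eq_conjTranspose] using hB⟩
  have outEq : ∀ X : Matrix d d ℂ, traceEnv (V₁ * X * V₁ᴴ) = traceEnv (V₂ * X * V₂ᴴ) := fun X =>
    (hV₁ X).1.symm.trans (hV₂ X).1
  rw [(hV₁ _).2, (hV₂ _).2, traceOut_conj, traceOut_conj,
    entropy_mul_conjTranspose_comm, entropy_mul_conjTranspose_comm]
  congr 1
  ext p q
  rw [traceEnv_conj, traceEnv_conj, outEq]

/-! Coherent information and quantum capacity -/

open Classical in
/-- The coherent information `I_c(ρ; Φ) = S(Φ(ρ)) - S(Φc(ρ))`, where `Φc` is a channel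
complementary to `Φ`.  The value does not depend on the choice of `Φc`, see `coherentInfo_eq`.
(The value `0` is used for maps that are not channels, i.e. have no complementary channel.) -/
def coherentInfo {d o : Type*} [Fintype d] [DecidableEq d] [Fintype o] [DecidableEq o]
    (Φ : Matrix d d ℂ →ₗ[ℂ] Matrix o o ℂ) (ρ : Matrix d d ℂ) : ℝ :=
  if h : ∃ (m : ℕ) (Φc : Matrix d d ℂ →ₗ[ℂ] Matrix (Fin m) (Fin m) ℂ), IsComplementary Φ Φc then
    entropy (Φ ρ) - entropy (h.choose_spec.choose ρ)
  else 0

/-- Relabelling the basis of the environment gives again a complementary channel. -/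
theorem IsComplementary.exists_fin {d o e : Type*} [Fintype d] [DecidableEq d] [Fintype o]
    [Fintype e] {Φ : Matrix d d ℂ →ₗ[ℂ] Matrix o o ℂ} {Φc : Matrix d d ℂ →ₗ[ℂ] Matrix e e ℂ}
    (h : IsComplementary Φ Φc) :
    ∃ (m : ℕ) (Ψ : Matrix d d ℂ →ₗ[ℂ] Matrix (Fin m) (Fin m) ℂ), IsComplementary Φ Ψ := by
  obtain ⟨V, hV, h⟩ := h
  let f := Fintype.equivFin e
  refine ⟨Fintype.card e, (Matrix.reindexLinearEquiv ℂ ℂ f f).toLinearMap ∘ₗ Φc,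
    V.submatrix (Prod.map id f.symm) id, ?_, fun X => ⟨?_, ?_⟩⟩
  · rw [← hV]
    ext i j
    simp only [Matrix.mul_apply, Matrix.conjTranspose_apply, Matrix.submatrix_apply,
      Fintype.sum_prod_type, Prod.map, id]
    exact Finset.sum_congr rfl fun a _ =>
      f.symm.sum_comp fun x => star (V (a, x) i) * V (a, x) j
  · rw [(h X).1]
    ext a b
    exact (f.symm.sum_comp fun x => (V * X * Vᴴ) (a, x) (b, x)).symm
  · ext x y
    simp only [LinearMap.comp_apply, LinearEquiv.coe_coe, Matrix.coe_reindexLinearEquiv, (h X).2]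
    rfl

/-- The coherent information may be computed with any complementary channel. -/
theorem coherentInfo_eq {d o e : Type*} [Fintype d] [DecidableEq d] [Fintype o] [DecidableEq o]
    [Fintype e] [DecidableEq e] {Φ : Matrix d d ℂ →ₗ[ℂ] Matrix o o ℂ}
    {Φc : Matrix d d ℂ →ₗ[ℂ] Matrix e e ℂ} (h : IsComplementary Φ Φc) {ρ : Matrix d d ℂ}
    (hρ : IsState ρ) : coherentInfo Φ ρ = entropy (Φ ρ) - entropy (Φc ρ) := by
  have h' := h.exists_fin
  rw [coherentInfo, dif_pos h', h'.choose_spec.choose_spec.entropy_eq h hρ.1]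

/-- The coherent information of a channel, `Q⁽¹⁾(Φ) = max_ρ I_c(ρ; Φ)` over all input states.
It is written as a supremum; for a channel with nonempty input space the set of values is
nonempty and bounded, and the supremum is attained, as the entropy is continuous and the set of
states is compact. -/
def channelCoherentInfo {d o : Type*} [Fintype d] [DecidableEq d] [Fintype o] [DecidableEq o]
    (Φ : Matrix d d ℂ →ₗ[ℂ] Matrix o o ℂ) : ℝ :=
  sSup {x | ∃ ρ : Matrix d d ℂ, IsState ρ ∧ x = coherentInfo Φ ρ}

/-- The tensor power `Φ^{⊗n}`.  The space `(ℂ^d)^{⊗n}` has the standard basis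
`|i 0⟩ ⊗ ⋯ ⊗ |i (n-1)⟩` indexed by `i : Fin n → d`, and `Φ^{⊗n}` maps the matrix unit
`E_{ij} = ⨂ k, E_{i k, j k}` to `⨂ k, Φ (E_{i k, j k})`. -/
def tensorPower {d o : Type*} [Fintype d] [DecidableEq d]
    (Φ : Matrix d d ℂ →ₗ[ℂ] Matrix o o ℂ) (n : ℕ) :
    Matrix (Fin n → d) (Fin n → d) ℂ →ₗ[ℂ] Matrix (Fin n → o) (Fin n → o) ℂ where
  toFun X := ∑ i, ∑ j, X i j •
    Matrix.of fun a b => ∏ k, Φ (Matrix.single (i k) (j k) 1) (a k) (b k)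
  map_add' X Y := by simp only [Matrix.add_apply, add_smul, Finset.sum_add_distrib]
  map_smul' c X := by
    simp only [Matrix.smul_apply, smul_eq_mul, mul_smul, Finset.smul_sum, RingHom.id_apply]

/-- `Φ^{⊗n}` maps `⨂ k, X k` to `⨂ k, Φ (X k)`. -/
theorem tensorPower_prod {d o : Type*} [Fintype d] [DecidableEq d]
    (Φ : Matrix d d ℂ →ₗ[ℂ] Matrix o o ℂ) (n : ℕ) (X : Fin n → Matrix d d ℂ) :
    tensorPower Φ n (Matrix.of fun i j => ∏ k, X k (i k) (j k)) =
      Matrix.of fun a b => ∏ k, Φ (X k) (a k) (b k) := by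
  ext a b
  have lin : ∀ k, Φ (X k) (a k) (b k) = ∑ p : d × d,
      X k p.1 p.2 * Φ (Matrix.single p.1 p.2 1) (a k) (b k) := by
    intro k
    conv_lhs => rw [Matrix.matrix_eq_sum_single (X k)]
    simp only [map_sum, Matrix.sum_apply, Fintype.sum_prod_type]
    refine Finset.sum_congr rfl fun i _ => Finset.sum_congr rfl fun j _ => ?_
    have hs : Matrix.single i j (X k i j) = X k i j • Matrix.single i j (1 : ℂ) := by simp
    rw [hs, map_smul, Matrix.smul_apply, smul_eq_mul]
  simp only [Matrix.of_apply, lin, tensorPower, LinearMap.coe_mk, AddHom.coe_mk, Matrix.sum_apply,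
    Matrix.smul_apply, smul_eq_mul]
  rw [Finset.prod_univ_sum, Fintype.piFinset_univ, ← Fintype.sum_prod_type',
    ← (Equiv.arrowProdEquivProdArrow (Fin n) (fun _ => d) (fun _ => d)).sum_comp]
  refine Finset.sum_congr rfl fun g _ => ?_
  rw [Finset.prod_mul_distrib]
  rfl

/-- `q` is the quantum capacity of the channel `Φ`:
`q = lim_{n → ∞} Q⁽¹⁾(Φ^{⊗n}) / n`, the limit being required to exist. -/
def HasQuantumCapacity {d o : Type*} [Fintype d] [DecidableEq d] [Fintype o] [DecidableEq o]
    (Φ : Matrix d d ℂ →ₗ[ℂ] Matrix o o ℂ) (q : ℝ) : Prop :=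
  Filter.Tendsto (fun n : ℕ => channelCoherentInfo (tensorPower Φ n) / n) Filter.atTop (nhds q)

/-! Generalized Pauli channels -/

/-- The shift matrix `X = ∑ k, |k + 1⟩⟨k|` (addition modulo `d`). -/
def shift (d : ℕ) : Matrix (Fin d) (Fin d) ℂ :=
  Matrix.of fun a b => if (a : ℕ) = ((b : ℕ) + 1) % d then 1 else 0

/-- The clock matrix `Z = ∑ k, ω ^ k |k⟩⟨k|` with `ω = exp (2 π i / d)`. -/
def clock (d : ℕ) : Matrix (Fin d) (Fin d) ℂ :=
  Matrix.diagonal fun k => Complex.exp (2 * Real.pi * Complex.I / d) ^ (k : ℕ)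

/-- The discrete Heisenberg–Weyl operators `U i j = X ^ i * Z ^ j`. -/
def weyl (d : ℕ) (i j : Fin d) : Matrix (Fin d) (Fin d) ℂ :=
  shift d ^ (i : ℕ) * clock d ^ (j : ℕ)

/-- The generalized Pauli channel `Φ_P(X) = ∑ i j, p i j • U i j * X * (U i j)ᴴ`. -/
def pauliChannel {d : ℕ} (P : Matrix (Fin d) (Fin d) ℝ) :
    Matrix (Fin d) (Fin d) ℂ →ₗ[ℂ] Matrix (Fin d) (Fin d) ℂ :=
  ∑ i, ∑ j, (P i j : ℂ) • LinearMap.mulLeftRight ℂ (weyl d i j, (weyl d i j)ᴴ)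

end

end QChannel

namespace QChannel

open scoped Kronecker

/-! Entropy of matrices given in diagonalized form -/

/-! It suffices to find one input state on which `Ψ` has positive coherent information. Tensor
products of inputs make `Q⁽¹⁾(Ψ^{⊗n})` superadditive in `n`, so by Fekete's lemma the limit exists,
equals the supremum of `Q⁽¹⁾(Ψ^{⊗n}) / n` over `n ≥ 1`, and is at least the one-copy value
(`IsComplementary.exists_hasQuantumCapacity`).

The state is a small perturbation `ρ = (1-ε)|ψ⟩⟨ψ| + ε·1/d` of a pure state. At `ε = 0` the outputs
of `Φ_P` and `Ψ` have the same nonzero spectrum `r`, so the coherent information vanishes there. Let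
`ψ` be such that the Weyl operators in the support of `P` send it, up to phases, onto all members of
an orthonormal basis. Then `Φ_P(ψ)` has full rank, and its entropy changes only by `O(ε)`
(`entropy_conj_diagonal_mix_le`). A complementary output lives on a space of dimension at least
`d+1` but has rank `d` at `ε = 0`. It therefore has a kernel, and filling the kernel with weight of
order `ε` contributes entropy at least `b ε log(1/ε)` (`le_entropy_add_diagonal`). For small `ε` the
logarithm wins (`exists_coherentInfo_pos`).

If every row of `P` is nonzero, `ψ = |0⟩` works. If every column is nonzero, the uniform
superposition works, with the Fourier basis as the orthonormal basis. -/

theorem isHermitian_conj_diagonal {n m : Type*} [Fintype n] [DecidableEq n]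
    (W : Matrix m n ℂ) (q : n → ℝ) :
    (W * Matrix.diagonal (fun i => (q i : ℂ)) * Wᴴ).IsHermitian := by
  refine Matrix.isHermitian_mul_mul_conjTranspose W ?_
  exact Matrix.isHermitian_diagonal_of_self_adjoint _ (by ext i; simp)

theorem entropy_conj_diagonal {n : Type*} [Fintype n] [DecidableEq n] {W : Matrix n n ℂ}
    (hW : Wᴴ * W = 1) (q : n → ℝ) :
    entropy (W * Matrix.diagonal (fun i => (q i : ℂ)) * Wᴴ) = ∑ i, Real.negMulLog (q i) := by
  rw [entropy_eq_roots (isHermitian_conj_diagonal W q), Matrix.charpoly_mul_comm,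
    ← Matrix.mul_assoc, hW, Matrix.one_mul, Matrix.charpoly_diagonal]
  have := Polynomial.roots_multiset_prod_X_sub_C (Finset.univ.val.map fun i => (q i : ℂ))
  rw [Multiset.map_map] at this
  erw [this]
  rw [Multiset.map_map]
  rfl

theorem entropy_submatrix {n m : Type*} [Fintype n] [DecidableEq n] [Fintype m] [DecidableEq m]
    {ρ : Matrix n n ℂ} (h : ρ.IsHermitian) (e : m ≃ n) :
    entropy (ρ.submatrix e e) = entropy ρ := by
  rw [entropy_eq_roots h, entropy_eq_roots (h.submatrix e), ← Matrix.charpoly_reindex e.symm ρ]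
  rfl

theorem IsState.exists_conj_diagonal {n : Type*} [Fintype n] [DecidableEq n] {ρ : Matrix n n ℂ}
    (h : IsState ρ) : ∃ (W : Matrix n n ℂ) (q : n → ℝ), Wᴴ * W = 1 ∧
      ρ = W * Matrix.diagonal (fun i => (q i : ℂ)) * Wᴴ ∧ (∀ i, 0 ≤ q i) ∧ ∑ i, q i = 1 := by
  refine ⟨h.1.1.eigenvectorUnitary, h.1.1.eigenvalues, ?_, ?_, h.1.eigenvalues_nonneg, ?_⟩
  · exact Unitary.coe_star_mul_self h.1.1.eigenvectorUnitary
  · exact h.1.1.spectral_theorem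
  · have := h.1.1.trace_eq_sum_eigenvalues
    simpa using congrArg Complex.re (this.symm.trans h.2)

/-- Concavity: the right side is the tangent to `-x log x` at `x = t`. Summed over two probability
vectors the terms `t - x` cancel, which leaves Gibbs' inequality. -/
theorem negMulLog_le_tangent {x t : ℝ} (hx : 0 ≤ x) (ht : 0 < t) :
    Real.negMulLog x ≤ -x * Real.log t + t - x := by
  rcases hx.eq_or_lt with rfl | hx
  · simpa using ht.le
  · have h := Real.log_le_sub_one_of_pos (div_pos ht hx)
    rw [Real.log_div ht.ne' hx.ne'] at h
    have := mul_le_mul_of_nonneg_left h hx.le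
    have e : x * (t / x - 1) = t - x := by field_simp
    rw [e] at this
    simp only [Real.negMulLog]
    linarith

theorem IsState.entropy_nonneg {n : Type*} [Fintype n] [DecidableEq n] {ρ : Matrix n n ℂ}
    (h : IsState ρ) : 0 ≤ entropy ρ := by
  obtain ⟨W, q, hW, rfl, hq, hs⟩ := h.exists_conj_diagonal
  rw [entropy_conj_diagonal hW]
  exact Finset.sum_nonneg fun i _ => Real.negMulLog_nonneg (hq i)
    (hs ▸ Finset.single_le_sum (fun j _ => hq j) (Finset.mem_univ i))

theorem IsState.entropy_le {n : Type*} [Fintype n] [DecidableEq n] {ρ : Matrix n n ℂ}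
    (h : IsState ρ) : entropy ρ ≤ Real.log (Fintype.card n) := by
  obtain ⟨W, q, hW, rfl, hq, hs⟩ := h.exists_conj_diagonal
  rw [entropy_conj_diagonal hW]
  have hn : (0 : ℝ) < Fintype.card n := by
    rcases isEmpty_or_nonempty n with hn | hn
    · simp at hs
    · exact_mod_cast Fintype.card_pos
  -- Tangent at the uniform distribution.
  refine (Finset.sum_le_sum fun i _ => negMulLog_le_tangent (hq i) (inv_pos.2 hn)).trans ?_
  rw [Finset.sum_sub_distrib, Finset.sum_add_distrib, ← Finset.sum_mul, Finset.sum_neg_distrib, hs,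
    Real.log_inv]
  simp [hn.ne']

theorem IsState.submatrix {n m : Type*} [Fintype n] [Fintype m]
    {ρ : Matrix n n ℂ} (h : IsState ρ) (e : m ≃ n) : IsState (ρ.submatrix e e) :=
  ⟨h.1.submatrix e, by rw [← h.2]; exact e.sum_comp fun i => ρ i i⟩

theorem IsState.kronecker {n m : Type*} [Fintype n] [DecidableEq n] [Fintype m] [DecidableEq m]
    {ρ : Matrix n n ℂ} {σ : Matrix m m ℂ} (hρ : IsState ρ) (hσ : IsState σ) :
    IsState (ρ ⊗ₖ σ) :=
  ⟨hρ.1.kronecker hσ.1, by rw [Matrix.trace_kronecker, hρ.2, hσ.2, one_mul]⟩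

theorem entropy_kronecker {n m : Type*} [Fintype n] [DecidableEq n] [Fintype m] [DecidableEq m]
    {ρ : Matrix n n ℂ} {σ : Matrix m m ℂ} (hρ : IsState ρ) (hσ : IsState σ) :
    entropy (ρ ⊗ₖ σ) = entropy ρ + entropy σ := by
  obtain ⟨W, q, hW, rfl, -, hq⟩ := hρ.exists_conj_diagonal
  obtain ⟨T, r, hT, rfl, -, hr⟩ := hσ.exists_conj_diagonal
  have hWT : (W ⊗ₖ T)ᴴ * (W ⊗ₖ T) = 1 := by
    rw [Matrix.conjTranspose_kronecker, ← Matrix.mul_kronecker_mul, hW, hT, Matrix.one_kronecker_one]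
  rw [Matrix.mul_kronecker_mul, Matrix.mul_kronecker_mul, ← Matrix.conjTranspose_kronecker,
    Matrix.diagonal_kronecker_diagonal]
  have := entropy_conj_diagonal hWT fun p => q p.1 * r p.2
  push_cast at this
  rw [this, entropy_conj_diagonal hW, entropy_conj_diagonal hT, Fintype.sum_prod_type]
  simp only [Real.negMulLog_mul, Finset.sum_add_distrib, ← Finset.sum_mul, ← Finset.mul_sum, hq,
    hr, one_mul]

/-! Elementary properties of complementary channels -/

theorem IsComplementary.symm {d o e : Type*} [Fintype d] [DecidableEq d] [Fintype o] [Fintype e]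
    {Φ : Matrix d d ℂ →ₗ[ℂ] Matrix o o ℂ} {Φc : Matrix d d ℂ →ₗ[ℂ] Matrix e e ℂ}
    (h : IsComplementary Φ Φc) : IsComplementary Φc Φ := by
  obtain ⟨V, hV, h⟩ := h
  refine ⟨V.submatrix Prod.swap id, ?_, fun X => ⟨(h X).2, (h X).1⟩⟩
  rw [← hV]
  ext i j
  exact (Equiv.prodComm e o).sum_comp fun a => star (V a i) * V a j

theorem IsComplementary.isState_right {d o e : Type*} [Fintype d] [DecidableEq d] [Fintype o]
    [Fintype e] {Φ : Matrix d d ℂ →ₗ[ℂ] Matrix o o ℂ} {Φc : Matrix d d ℂ →ₗ[ℂ] Matrix e e ℂ}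
    (h : IsComplementary Φ Φc) {ρ : Matrix d d ℂ} (hρ : IsState ρ) : IsState (Φc ρ) := by
  obtain ⟨V, hV, h⟩ := h
  rw [(h ρ).2]
  constructor
  · obtain ⟨B, rfl⟩ : ∃ B : Matrix d d ℂ, ρ = B * Bᴴ := by
      open scoped MatrixOrder in
      obtain ⟨B, hB⟩ := CStarAlgebra.nonneg_iff_eq_star_mul_self.mp hρ.1.nonneg
      exact ⟨Bᴴ, by simpa [Matrix.star_eq_conjTranspose] using hB⟩
    rw [traceOut_conj]
    exact Matrix.posSemidef_self_mul_conjTranspose _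
  · have : (traceOut (V * ρ * Vᴴ)).trace = (V * ρ * Vᴴ).trace := by
      simp only [Matrix.trace, Matrix.diag_apply, traceOut, Matrix.of_apply, Fintype.sum_prod_type]
      exact Finset.sum_comm
    rw [this, Matrix.trace_mul_comm, ← Matrix.mul_assoc, hV, Matrix.one_mul, hρ.2]

theorem IsComplementary.isState_left {d o e : Type*} [Fintype d] [DecidableEq d] [Fintype o]
    [Fintype e] {Φ : Matrix d d ℂ →ₗ[ℂ] Matrix o o ℂ} {Φc : Matrix d d ℂ →ₗ[ℂ] Matrix e e ℂ}
    (h : IsComplementary Φ Φc) {ρ : Matrix d d ℂ} (hρ : IsState ρ) : IsState (Φ ρ) :=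
  h.symm.isState_right hρ

/-! Tensor powers -/

theorem traceEnv_conj_apply {d o e : Type*} [Fintype d] [Fintype e] (V : Matrix (o × e) d ℂ)
    (X : Matrix d d ℂ) (a b : o) :
    traceEnv (V * X * Vᴴ) a b = ∑ i, ∑ j, X i j * ∑ x, V (a, x) i * star (V (b, x) j) := by
  simp only [traceEnv, Matrix.of_apply, Matrix.mul_apply, Matrix.conjTranspose_apply,
    Finset.sum_mul, Finset.mul_sum]
  rw [Finset.sum_comm]
  conv_rhs => rw [Finset.sum_comm]
  refine Finset.sum_congr rfl fun j _ => ?_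
  rw [Finset.sum_comm]
  exact Finset.sum_congr rfl fun i _ => Finset.sum_congr rfl fun x _ => by ring

/-- `W` is `V^{⊗n}` with all output factors grouped before all environment factors. Expanding a
product of sums over `x k` gives a single sum over tuples `x`. -/
theorem tensorPower_traceEnv {d o e : Type*} [Fintype d] [DecidableEq d] [Fintype e]
    {Φ : Matrix d d ℂ →ₗ[ℂ] Matrix o o ℂ} {V : Matrix (o × e) d ℂ}
    (h : ∀ X, Φ X = traceEnv (V * X * Vᴴ)) (n : ℕ) (X : Matrix (Fin n → d) (Fin n → d) ℂ)
    {W : Matrix ((Fin n → o) × (Fin n → e)) (Fin n → d) ℂ}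
    (hW : ∀ a x i, W (a, x) i = ∏ k, V (a k, x k) (i k)) :
    tensorPower Φ n X = traceEnv (W * X * Wᴴ) := by
  classical
  have hs : ∀ i j a b, Φ (Matrix.single i j 1) a b = ∑ x, V (a, x) i * star (V (b, x) j) := by
    intro i j a b
    rw [h, traceEnv_conj_apply, Finset.sum_eq_single i, Finset.sum_eq_single j]
    · simp
    · intro k _ hk
      simp [Matrix.single_apply_of_col_ne _ _ hk.symm]
    · simp
    · intro k _ hk
      simp [Matrix.single_apply_of_row_ne hk.symm]
    · simp
  ext a b
  rw [traceEnv_conj_apply]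
  simp only [tensorPower, LinearMap.coe_mk, AddHom.coe_mk, Matrix.sum_apply, Matrix.smul_apply,
    Matrix.of_apply, smul_eq_mul, hs, hW]
  refine Finset.sum_congr rfl fun i _ => Finset.sum_congr rfl fun j _ => ?_
  rw [Finset.prod_univ_sum, Fintype.piFinset_univ]
  simp [Finset.prod_mul_distrib]

theorem IsComplementary.tensorPower {d o e : Type*} [Fintype d] [DecidableEq d] [Fintype o]
    [Fintype e] {Φ : Matrix d d ℂ →ₗ[ℂ] Matrix o o ℂ} {Φc : Matrix d d ℂ →ₗ[ℂ] Matrix e e ℂ}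
    (h : IsComplementary Φ Φc) (n : ℕ) :
    IsComplementary (tensorPower Φ n) (tensorPower Φc n) := by
  classical
  obtain ⟨V, hV, h⟩ := h
  refine ⟨Matrix.of fun p i => ∏ k, V (p.1 k, p.2 k) (i k), ?_, fun X => ⟨?_, ?_⟩⟩
  · ext i j
    have h1 : ∀ k, ∑ p : o × e, star (V p (i k)) * V p (j k) = (1 : Matrix d d ℂ) (i k) (j k) := by
      intro k
      rw [← hV]
      rfl
    rw [Matrix.mul_apply, ← (Equiv.arrowProdEquivProdArrow (Fin n) (fun _ => o) (fun _ => e)).sum_comp]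
    have : (1 : Matrix (Fin n → d) (Fin n → d) ℂ) i j = ∏ k, (1 : Matrix d d ℂ) (i k) (j k) := by
      simp only [Matrix.one_apply, funext_iff, Finset.prod_ite_zero]
      simp
    rw [this]
    simp only [← h1]
    rw [Finset.prod_univ_sum, Fintype.piFinset_univ]
    refine Finset.sum_congr rfl fun g _ => ?_
    simp [Finset.prod_mul_distrib, Equiv.arrowProdEquivProdArrow]
  · exact tensorPower_traceEnv (fun X => (h X).1) n X fun a x i => rfl
  -- Swapping output and environment in `V` turns one partial trace into the other.
  · have h' : ∀ X, Φc X = traceEnv ((V.submatrix Prod.swap id) * X * (V.submatrix Prod.swap id)ᴴ) :=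
      fun X => (h X).2
    exact tensorPower_traceEnv (W := Matrix.of fun p i => ∏ k, V (p.2 k, p.1 k) (i k)) h' n X
      fun a x i => rfl

theorem tensorPower_add {d o : Type*} [Fintype d] [DecidableEq d]
    (Φ : Matrix d d ℂ →ₗ[ℂ] Matrix o o ℂ) (m n : ℕ) (ρ : Matrix (Fin m → d) (Fin m → d) ℂ)
    (σ : Matrix (Fin n → d) (Fin n → d) ℂ) :
    tensorPower Φ (m + n) ((ρ ⊗ₖ σ).submatrix (Fin.appendEquiv m n).symm (Fin.appendEquiv m n).symm)
      = (tensorPower Φ m ρ ⊗ₖ tensorPower Φ n σ).submatrix (Fin.appendEquiv m n).symm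
        (Fin.appendEquiv m n).symm := by
  ext a b
  obtain ⟨⟨a₁, a₂⟩, rfl⟩ := (Fin.appendEquiv m n).surjective a
  obtain ⟨⟨b₁, b₂⟩, rfl⟩ := (Fin.appendEquiv m n).surjective b
  simp only [Matrix.submatrix_apply, Equiv.symm_apply_apply, Matrix.kronecker_apply]
  simp only [tensorPower, LinearMap.coe_mk, AddHom.coe_mk, Matrix.sum_apply, Matrix.smul_apply,
    Matrix.of_apply, smul_eq_mul, Matrix.submatrix_apply]
  rw [← (Fin.appendEquiv m n).sum_comp]
  simp only [← (Fin.appendEquiv m n).sum_comp (M := ℂ), Equiv.symm_apply_apply,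
    Matrix.kronecker_apply, Fin.prod_univ_add, Fintype.sum_prod_type]
  simp only [Fin.appendEquiv, Equiv.coe_fn_mk, Fin.append_left, Fin.append_right]
  simp only [Finset.sum_mul_sum]
  exact Finset.sum_congr rfl fun i _ => Finset.sum_congr rfl fun i' _ =>
    Finset.sum_congr rfl fun j _ => Finset.sum_congr rfl fun j' _ => by ring

open scoped Kronecker

/-! Existence of the quantum capacity -/

theorem exists_isState (n : Type*) [Fintype n] [DecidableEq n] [Nonempty n] :
    ∃ ρ : Matrix n n ℂ, IsState ρ := by
  obtain ⟨i⟩ := ‹Nonempty n›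
  refine ⟨Matrix.diagonal (Pi.single i 1), Matrix.PosSemidef.diagonal ?_, ?_⟩
  · exact Pi.single_nonneg.2 zero_le_one
  · simp [Matrix.trace_diagonal]

theorem tensorPower_one {d o : Type*} [Fintype d] [DecidableEq d]
    (Φ : Matrix d d ℂ →ₗ[ℂ] Matrix o o ℂ) (ρ : Matrix d d ℂ) : tensorPower Φ 1
      (ρ.submatrix (Equiv.funUnique (Fin 1) d) (Equiv.funUnique (Fin 1) d)) =
      (Φ ρ).submatrix (Equiv.funUnique (Fin 1) o) (Equiv.funUnique (Fin 1) o) := by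
  have := tensorPower_prod Φ 1 fun _ => ρ
  simp only [Fin.prod_univ_one] at this
  exact this

/-! ### Superadditivity of the coherent information and Fekete's lemma. -/

section

variable {d o e : Type*} [Fintype d] [DecidableEq d] [Fintype o] [DecidableEq o] [Fintype e]
  [DecidableEq e] {Φ : Matrix d d ℂ →ₗ[ℂ] Matrix o o ℂ} {Φc : Matrix d d ℂ →ₗ[ℂ] Matrix e e ℂ}

theorem IsComplementary.coherentInfo_le (h : IsComplementary Φ Φc) {ρ : Matrix d d ℂ}
    (hρ : IsState ρ) : coherentInfo Φ ρ ≤ Real.log (Fintype.card o) := by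
  rw [coherentInfo_eq h hρ]
  linarith [(h.isState_left hρ).entropy_le, (h.isState_right hρ).entropy_nonneg]

theorem IsComplementary.le_channelCoherentInfo (h : IsComplementary Φ Φc) {ρ : Matrix d d ℂ}
    (hρ : IsState ρ) : coherentInfo Φ ρ ≤ channelCoherentInfo Φ := by
  refine le_csSup ⟨Real.log (Fintype.card o), ?_⟩ ⟨ρ, hρ, rfl⟩
  rintro _ ⟨σ, hσ, rfl⟩
  exact h.coherentInfo_le hσ

theorem channelCoherentInfo_le [Nonempty d] {x : ℝ}
    (h : ∀ ρ : Matrix d d ℂ, IsState ρ → coherentInfo Φ ρ ≤ x) : channelCoherentInfo Φ ≤ x := by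
  obtain ⟨ρ, hρ⟩ := exists_isState d
  refine csSup_le ⟨_, ρ, hρ, rfl⟩ ?_
  rintro _ ⟨σ, hσ, rfl⟩
  exact h σ hσ

/-- Both outputs of a product state are product states, and entropy is additive on these. -/
theorem IsComplementary.coherentInfo_append (h : IsComplementary Φ Φc) {m n : ℕ}
    {ρ : Matrix (Fin m → d) (Fin m → d) ℂ} {σ : Matrix (Fin n → d) (Fin n → d) ℂ}
    (hρ : IsState ρ) (hσ : IsState σ) :
    coherentInfo (QChannel.tensorPower Φ (m + n))
      ((ρ ⊗ₖ σ).submatrix (Fin.appendEquiv m n).symm (Fin.appendEquiv m n).symm) =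
    coherentInfo (QChannel.tensorPower Φ m) ρ + coherentInfo (QChannel.tensorPower Φ n) σ := by
  have hm := h.tensorPower m
  have hn := h.tensorPower n
  have ho := (hm.isState_left hρ).kronecker (hn.isState_left hσ)
  have he := (hm.isState_right hρ).kronecker (hn.isState_right hσ)
  rw [coherentInfo_eq (h.tensorPower (m + n)) ((hρ.kronecker hσ).submatrix _),
    coherentInfo_eq hm hρ, coherentInfo_eq hn hσ, tensorPower_add, tensorPower_add,
    entropy_submatrix ho.1.1, entropy_submatrix he.1.1,
    entropy_kronecker (hm.isState_left hρ) (hn.isState_left hσ),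
    entropy_kronecker (hm.isState_right hρ) (hn.isState_right hσ)]
  ring

theorem IsComplementary.channelCoherentInfo_add_le [Nonempty d] (h : IsComplementary Φ Φc)
    (m n : ℕ) :
    channelCoherentInfo (QChannel.tensorPower Φ m) + channelCoherentInfo (QChannel.tensorPower Φ n)
      ≤ channelCoherentInfo (QChannel.tensorPower Φ (m + n)) := by
  rw [← le_sub_iff_add_le]
  refine channelCoherentInfo_le fun ρ hρ => ?_
  rw [le_sub_comm]
  refine channelCoherentInfo_le fun σ hσ => ?_
  have := (h.tensorPower (m + n)).le_channelCoherentInfo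
    ((hρ.kronecker hσ).submatrix (Fin.appendEquiv m n).symm)
  rw [h.coherentInfo_append hρ hσ] at this
  linarith

theorem IsComplementary.coherentInfo_tensorPower_one (h : IsComplementary Φ Φc)
    {ρ : Matrix d d ℂ} (hρ : IsState ρ) :
    coherentInfo (QChannel.tensorPower Φ 1)
      (ρ.submatrix (Equiv.funUnique (Fin 1) d) (Equiv.funUnique (Fin 1) d)) =
    coherentInfo Φ ρ := by
  rw [coherentInfo_eq (h.tensorPower 1) (hρ.submatrix _), coherentInfo_eq h hρ, tensorPower_one,
    tensorPower_one, entropy_submatrix (h.isState_left hρ).1.1, entropy_submatrix (h.isState_right hρ).1.1]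

/-- The limit defining the quantum capacity exists, and it is at least the coherent information of
every state. -/
theorem IsComplementary.exists_hasQuantumCapacity (h : IsComplementary Φ Φc) {ρ : Matrix d d ℂ}
    (hρ : IsState ρ) : ∃ q, HasQuantumCapacity Φ q ∧ coherentInfo Φ ρ ≤ q := by
  have : Nonempty d := by
    by_contra hd
    rw [not_nonempty_iff] at hd
    simpa [Matrix.trace] using hρ.2
  -- Fekete's lemma is stated for subadditive sequences, hence the sign.
  have hsub : Subadditive fun n => -channelCoherentInfo (QChannel.tensorPower Φ n) := by
    intro m n
    linarith [h.channelCoherentInfo_add_le m n]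
  have hbdd : BddBelow
      (Set.range fun n : ℕ => -channelCoherentInfo (QChannel.tensorPower Φ n) / n) := by
    refine ⟨-Real.log (Fintype.card o), ?_⟩
    rintro _ ⟨n, rfl⟩
    have hle : channelCoherentInfo (QChannel.tensorPower Φ n) ≤ n * Real.log (Fintype.card o) := by
      refine channelCoherentInfo_le fun σ hσ => ((h.tensorPower n).coherentInfo_le hσ).trans_eq ?_
      simp
    rcases n.eq_zero_or_pos with rfl | hn
    -- At `n = 0` the quotient is `0` by the convention for division by zero.
    · simpa using Real.log_natCast_nonneg _
    · dsimp only
      rw [le_div_iff₀ (by exact_mod_cast hn)]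
      linarith
  refine ⟨-hsub.lim, ?_, ?_⟩
  · refine (hsub.tendsto_lim hbdd).neg.congr fun n => ?_
    rw [neg_div, neg_neg]
  -- The Fekete limit is an infimum, so the term `n = 1` bounds it.
  · have h1 := hsub.lim_le_div hbdd one_ne_zero
    have h2 := (h.tensorPower 1).le_channelCoherentInfo
      (hρ.submatrix (Equiv.funUnique (Fin 1) d))
    rw [h.coherentInfo_tensorPower_one hρ] at h2
    simp only [Nat.cast_one, div_one] at h1
    linarith

end

/-! Entropy of a perturbation of a singular state -/

/-- Jensen's inequality for the convex function `-log` with weights `w` of total mass `R`, proved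
from the tangent at `t`. No normalization by `R` is needed, so `R = 0` is harmless. -/
theorem le_sum_mul_neg_log {α : Type*} [Fintype α] {q w : α → ℝ} {R t : ℝ} (hq : ∀ a, 0 < q a)
    (hw : ∀ a, 0 ≤ w a) (hR : ∑ a, w a = R) (ht : 0 < t) (hT : ∑ a, q a * w a ≤ R * t) :
    R * -Real.log t ≤ ∑ a, -Real.log (q a) * w a := by
  have key : ∀ a, w a - q a * w a / t + -Real.log t * w a ≤ -Real.log (q a) * w a := by
    intro a
    have h := Real.log_le_sub_one_of_pos (div_pos (hq a) ht)
    rw [Real.log_div (hq a).ne' ht.ne'] at h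
    have := mul_le_mul_of_nonneg_right h (hw a)
    have e : q a * w a / t = q a / t * w a := by ring
    rw [e]
    linarith
  refine le_trans ?_ (Finset.sum_le_sum fun a _ => key a)
  rw [Finset.sum_add_distrib, Finset.sum_sub_distrib, ← Finset.sum_div, ← Finset.mul_sum, hR]
  have : (∑ a, q a * w a) / t ≤ R := by rwa [div_le_iff₀ ht]
  linarith

/-- Stated for rectangular `B` so that it evaluates the quadratic forms of a spectral decomposition,
of `G Gᴴ` and of a diagonal matrix alike. -/
theorem dotProduct_conj_diagonal_mulVec {n m : Type*} [Fintype n] [DecidableEq n] [Fintype m]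
    (B : Matrix m n ℂ) (x : n → ℝ) (v : m → ℂ) :
    star v ⬝ᵥ ((B * Matrix.diagonal (fun i => (x i : ℂ)) * Bᴴ) *ᵥ v) =
      ((∑ i, x i * Complex.normSq ((Bᴴ *ᵥ v) i) : ℝ) : ℂ) := by
  rw [← Matrix.mulVec_mulVec, ← Matrix.mulVec_mulVec, Matrix.dotProduct_mulVec]
  have : star v ᵥ* B = star (Bᴴ *ᵥ v) := by rw [Matrix.star_mulVec, Matrix.conjTranspose_conjTranspose]
  rw [this]
  simp only [dotProduct, Matrix.mulVec_diagonal, Pi.star_apply, Complex.ofReal_sum,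
    Complex.ofReal_mul, Complex.normSq_eq_conj_mul_self]
  exact Finset.sum_congr rfl fun i _ => by
    simp only [RCLike.star_def]; ring

/-- Each eigenvalue `q a` of the mixture `M` splits into a `G` part and a `p` part. Weighting this
splitting by `-log (q a)` and summing expresses the entropy as two averages of `-log q`, each
bounded by Jensen. The columns of `G` recover the unperturbed entropy, while a kernel vector of
`Gᴴ`, on which the form of `M` is at most `ε`, yields the factor `-log ε`. -/
theorem le_entropy_add_diagonal {S ι : Type*} [Fintype S] [DecidableEq S] [Fintype ι]
    [DecidableEq ι] {G : Matrix S ι ℂ} {p : S → ℝ} {r : ι → ℝ} {k : S → ℂ} {b ε : ℝ}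
    (hb : 0 < b) (hbp : ∀ s, b ≤ p s) (hp1 : ∀ s, p s ≤ 1) (hr : ∀ i, 0 < r i)
    (hG : Gᴴ * G = Matrix.diagonal fun i => (r i : ℂ))
    (hGp : ∀ i, ∑ s, p s * Complex.normSq (G s i) ≤ r i ^ 2)
    (hk : k ≠ 0) (hGk : Gᴴ *ᵥ k = 0) (hε : 0 < ε) (hε1 : ε < 1)
    (hM : IsState (((1 - ε : ℝ) : ℂ) • (G * Gᴴ) +
      (ε : ℂ) • Matrix.diagonal fun s => (p s : ℂ))) :
    (1 - ε) * ∑ i, Real.negMulLog (r i) + ε * (b * -Real.log ε) ≤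
      entropy (((1 - ε : ℝ) : ℂ) • (G * Gᴴ) + (ε : ℂ) • Matrix.diagonal fun s => (p s : ℂ)) := by
  obtain ⟨W, q, hW, hMW, hq0, hq1⟩ := hM.exists_conj_diagonal
  have hW' : W * Wᴴ = 1 := mul_eq_one_comm.1 hW
  -- The quadratic form of `M`, computed from its spectrum and from its definition.
  have form : ∀ v : S → ℂ, ∑ a, q a * Complex.normSq ((Wᴴ *ᵥ v) a) =
      (1 - ε) * ∑ i, Complex.normSq ((Gᴴ *ᵥ v) i) + ε * ∑ s, p s * Complex.normSq (v s) := by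
    intro v
    have h1 := dotProduct_conj_diagonal_mulVec W q v
    have h2 := dotProduct_conj_diagonal_mulVec G (fun _ => 1) v
    have h3 := dotProduct_conj_diagonal_mulVec (1 : Matrix S S ℂ) p v
    rw [← hMW, Matrix.add_mulVec, dotProduct_add, Matrix.smul_mulVec, Matrix.smul_mulVec,
      dotProduct_smul, dotProduct_smul] at h1
    simp only [Complex.ofReal_one, Matrix.diagonal_one, Matrix.mul_one] at h2
    simp only [Matrix.conjTranspose_one, Matrix.one_mul, Matrix.mul_one, Matrix.one_mulVec] at h3
    rw [h2, h3] at h1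
    simp only [one_mul, smul_eq_mul] at h1
    exact_mod_cast h1.symm
  have norm : ∀ v : S → ℂ, ∑ a, Complex.normSq ((Wᴴ *ᵥ v) a) = ∑ s, Complex.normSq (v s) := by
    intro v
    have h2 := dotProduct_conj_diagonal_mulVec W (fun _ => 1) v
    have h3 := dotProduct_conj_diagonal_mulVec (1 : Matrix S S ℂ) (fun _ => 1) v
    simp only [Complex.ofReal_one, Matrix.diagonal_one, Matrix.mul_one, hW', one_mul,
      Matrix.conjTranspose_one, Matrix.one_mulVec] at h2 h3
    exact_mod_cast h2.symm.trans h3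
  have hWcol : ∀ a, Wᴴ *ᵥ W.col a = Pi.single a 1 := by
    intro a
    rw [← Matrix.mulVec_single_one, Matrix.mulVec_mulVec, hW, Matrix.one_mulVec]
  -- The form evaluated at the eigenvector `W.col a`.
  have hq : ∀ a, q a = (1 - ε) * ∑ i, Complex.normSq ((Wᴴ *ᵥ G.col i) a) +
      ε * ∑ s, p s * Complex.normSq (W s a) := by
    intro a
    have h := form (W.col a)
    rw [hWcol, Finset.sum_eq_single a (by intro c _ hc; simp [hc]) (by simp)] at h
    simp only [Pi.single_eq_same, Complex.normSq_one, mul_one] at h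
    rw [h]
    congr 3
    ext i
    have : (Gᴴ *ᵥ W.col a) i = star ((Wᴴ *ᵥ G.col i) a) := by
      simp [Matrix.mulVec, dotProduct, mul_comm]
    rw [this]
    exact Complex.normSq_conj _
  have hWa : ∀ a, ∑ s, Complex.normSq (W s a) = 1 := by
    intro a
    have h := norm (W.col a)
    rw [hWcol, Finset.sum_eq_single a (by intro c _ hc; simp [hc]) (by simp)] at h
    simpa using h.symm
  have hpW : ∀ a, b ≤ ∑ s, p s * Complex.normSq (W s a) := by
    intro a
    rw [← mul_one b, ← hWa a, Finset.mul_sum]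
    exact Finset.sum_le_sum fun s _ => mul_le_mul_of_nonneg_right (hbp s) (Complex.normSq_nonneg _)
  have hqpos : ∀ a, 0 < q a := by
    intro a
    rw [hq a]
    exact add_pos_of_nonneg_of_pos
      (mul_nonneg (by linarith) (Finset.sum_nonneg fun i _ => Complex.normSq_nonneg _))
      (mul_pos hε (hb.trans_le (hpW a)))
  have hqle : ∀ a, q a ≤ 1 := fun a =>
    hq1 ▸ Finset.single_le_sum (fun c _ => hq0 c) (Finset.mem_univ a)
  have hl : ∀ a, 0 ≤ -Real.log (q a) := fun a => by
    linarith [Real.log_nonpos (hq0 a) (hqle a)]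
  have hGr : ∀ i, ∑ s, Complex.normSq (G s i) = r i := by
    intro i
    have h := congrFun (congrFun hG i) i
    rw [Matrix.mul_apply, Matrix.diagonal_apply_eq] at h
    have e : ∀ s, Gᴴ i s * G s i = (Complex.normSq (G s i) : ℂ) := fun s => by
      rw [Complex.normSq_eq_conj_mul_self]; rfl
    simp only [e] at h
    exact_mod_cast h
  -- Jensen at `t = r i`: the weights have mass `r i`, and the form of `M` at the column `G.col i`
  -- is at most `r i ^ 2`, by `hGp` for the part of weight `ε`.
  have hGi : ∀ i, Real.negMulLog (r i) ≤
      ∑ a, -Real.log (q a) * Complex.normSq ((Wᴴ *ᵥ G.col i) a) := by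
    intro i
    have h := le_sum_mul_neg_log (t := r i) hqpos
      (fun a => Complex.normSq_nonneg ((Wᴴ *ᵥ G.col i) a))
      ((norm (G.col i)).trans (hGr i)) (hr i) ?_
    · rw [Real.negMulLog]; linarith
    · rw [form]
      have e : Gᴴ *ᵥ G.col i = Pi.single i (r i : ℂ) := by
        rw [← Matrix.mulVec_single_one, Matrix.mulVec_mulVec, hG, Matrix.diagonal_mulVec_single,
          mul_one]
      rw [e, Finset.sum_eq_single i (by intro c _ hc; simp [hc]) (by simp), Pi.single_eq_same,
        Complex.normSq_ofReal]
      have := mul_le_mul_of_nonneg_left (hGp i) hε.le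
      simp only [Matrix.col_apply]
      linarith
  obtain ⟨κ, hκ⟩ : ∃ κ, κ = ∑ s, Complex.normSq (k s) := ⟨_, rfl⟩
  have hκ0 : 0 < κ := by
    obtain ⟨s, hs⟩ := Function.ne_iff.1 hk
    rw [hκ]
    exact Finset.sum_pos' (fun _ _ => Complex.normSq_nonneg _)
      ⟨s, Finset.mem_univ s, Complex.normSq_pos.2 hs⟩
  have hkκ := (norm k).trans hκ.symm
  have hkl : κ * -Real.log ε ≤ ∑ a, -Real.log (q a) * Complex.normSq ((Wᴴ *ᵥ k) a) := by
    refine le_sum_mul_neg_log hqpos (fun a => Complex.normSq_nonneg _) hkκ hε ?_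
    rw [form, hGk, mul_comm κ, hκ]
    simp only [Pi.zero_apply, map_zero, Finset.sum_const_zero, mul_zero, zero_add]
    refine mul_le_mul_of_nonneg_left (Finset.sum_le_sum fun s _ => ?_) hε.le
    exact mul_le_of_le_one_left (Complex.normSq_nonneg _) (hp1 s)
  -- All `-log (q a)` are nonnegative and each weight is at most `κ`, so the weights may be replaced
  -- by `κ`, which then cancels.
  have hlog : -Real.log ε ≤ ∑ a, -Real.log (q a) := by
    have : ∑ a, -Real.log (q a) * Complex.normSq ((Wᴴ *ᵥ k) a) ≤ ∑ a, -Real.log (q a) * κ := by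
      refine Finset.sum_le_sum fun a _ => mul_le_mul_of_nonneg_left ?_ (hl a)
      rw [← hkκ]
      exact Finset.single_le_sum (f := fun a => Complex.normSq ((Wᴴ *ᵥ k) a))
        (fun c _ => Complex.normSq_nonneg _) (Finset.mem_univ a)
    rw [← Finset.sum_mul] at this
    exact le_of_mul_le_mul_left (by linarith) hκ0
  have hB : b * -Real.log ε ≤ ∑ a, -Real.log (q a) * ∑ s, p s * Complex.normSq (W s a) := by
    refine (mul_le_mul_of_nonneg_left hlog hb.le).trans ?_
    rw [Finset.mul_sum]
    refine Finset.sum_le_sum fun a _ => ?_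
    rw [mul_comm b]
    exact mul_le_mul_of_nonneg_left (hpW a) (hl a)
  have hE : entropy (((1 - ε : ℝ) : ℂ) • (G * Gᴴ) + (ε : ℂ) • Matrix.diagonal fun s => (p s : ℂ)) =
      (1 - ε) * ∑ i, ∑ a, -Real.log (q a) * Complex.normSq ((Wᴴ *ᵥ G.col i) a) +
        ε * ∑ a, -Real.log (q a) * ∑ s, p s * Complex.normSq (W s a) := by
    rw [hMW, entropy_conj_diagonal hW, Finset.sum_comm, Finset.mul_sum, Finset.mul_sum,
      ← Finset.sum_add_distrib]
    refine Finset.sum_congr rfl fun a _ => ?_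
    rw [← Finset.mul_sum, Real.negMulLog]
    linear_combination (-Real.log (q a)) * hq a
  rw [hE]
  exact add_le_add
    (mul_le_mul_of_nonneg_left (Finset.sum_le_sum fun i _ => hGi i) (by linarith))
    (mul_le_mul_of_nonneg_left hB hε.le)

/-- Bound each term by the tangent to `-x log x` at `r i`. Its slope is finite because `r i > 0`, so
the cost of the perturbation is linear in `ε`. -/
theorem entropy_conj_diagonal_mix_le {n : Type*} [Fintype n] [DecidableEq n] {W : Matrix n n ℂ}
    (hW : Wᴴ * W = 1) {r u : n → ℝ} (hr : ∀ i, 0 < r i) (hr1 : ∑ i, r i = 1) (hu : ∀ i, 0 ≤ u i)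
    (hu1 : ∑ i, u i = 1) {ε : ℝ} (hε : 0 ≤ ε) (hε1 : ε ≤ 1) :
    entropy (W * Matrix.diagonal (fun i => (((1 - ε) * r i + ε * u i : ℝ) : ℂ)) * Wᴴ) ≤
      (1 - ε) * ∑ i, Real.negMulLog (r i) + ε * ∑ i, u i * -Real.log (r i) := by
  rw [entropy_conj_diagonal hW]
  refine (Finset.sum_le_sum fun i _ => negMulLog_le_tangent (t := r i) ?_ (hr i)).trans ?_
  · exact add_nonneg (mul_nonneg (by linarith) (hr i).le) (mul_nonneg hε (hu i))
  have e : ∀ i, -((1 - ε) * r i + ε * u i) * Real.log (r i) + r i - ((1 - ε) * r i + ε * u i) =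
      (1 - ε) * Real.negMulLog (r i) + ε * (u i * -Real.log (r i)) + ε * r i - ε * u i := by
    intro i
    rw [Real.negMulLog]
    ring
  simp only [e, Finset.sum_add_distrib, Finset.sum_sub_distrib, ← Finset.mul_sum, hr1, hu1]
  linarith

theorem exists_lt_mul_neg_log {b : ℝ} (hb : 0 < b) (C : ℝ) :
    ∃ ε : ℝ, 0 < ε ∧ ε < 1 ∧ C < b * -Real.log ε := by
  -- With this choice `b * -log ε = |C| + 1`.
  refine ⟨Real.exp (-((|C| + 1) / b)), Real.exp_pos _, ?_, ?_⟩
  · rw [Real.exp_lt_one_iff]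
    have : 0 < (|C| + 1) / b := by positivity
    linarith
  · rw [Real.log_exp, neg_neg, mul_div_cancel₀ _ hb.ne']
    linarith [le_abs_self C]

/-! Mixtures of unitary conjugations -/

/-- The Stinespring isometry `|y⟩ ↦ ∑ s, √(p s) U s |y⟩ ⊗ |s⟩`. -/
noncomputable def mixedUnitaryIsometry {d S : Type*} (p : S → ℝ) (U : S → Matrix d d ℂ) :
    Matrix (d × S) d ℂ :=
  Matrix.of fun a b => (Real.sqrt (p a.2) : ℂ) * U a.2 a.1 b

/-- The complementary channel `Y ↦ ∑ s t, √(p s) √(p t) Tr (U s Y (U t)ᴴ) |s⟩⟨t|` of a mixture of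
unitary conjugations. -/
noncomputable def mixedUnitaryComplement {d S : Type*} [Fintype d] (p : S → ℝ)
    (U : S → Matrix d d ℂ) :
    Matrix d d ℂ →ₗ[ℂ] Matrix S S ℂ where
  toFun X := Matrix.of fun s t =>
    (Real.sqrt (p s) : ℂ) * Real.sqrt (p t) * (U s * X * (U t)ᴴ).trace
  map_add' X Y := by
    ext s t
    simp [Matrix.add_mul, mul_add]
  map_smul' c X := by
    ext s t
    simp [mul_left_comm]

theorem isComplementary_mixedUnitaryComplement {d S : Type*} [Fintype d] [DecidableEq d]
    [Fintype S] {Φ : Matrix d d ℂ →ₗ[ℂ] Matrix d d ℂ} {p : S → ℝ} {U : S → Matrix d d ℂ}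
    (hp : ∀ s, 0 ≤ p s) (hp1 : ∑ s, p s = 1) (hU : ∀ s, (U s)ᴴ * U s = 1)
    (hΦ : ∀ X, Φ X = ∑ s, (p s : ℂ) • (U s * X * (U s)ᴴ)) :
    IsComplementary Φ (mixedUnitaryComplement p U) := by
  have hsq : ∀ s, (Real.sqrt (p s) : ℂ) * Real.sqrt (p s) = p s := fun s => by
    exact_mod_cast Real.mul_self_sqrt (hp s)
  have hV : ∀ (X : Matrix d d ℂ) a s b t,
      (mixedUnitaryIsometry p U * X * (mixedUnitaryIsometry p U)ᴴ) (a, s) (b, t) =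
        (Real.sqrt (p s) : ℂ) * Real.sqrt (p t) * (U s * X * (U t)ᴴ) a b := by
    intro X a s b t
    simp only [Matrix.mul_apply, mixedUnitaryIsometry, Matrix.of_apply,
      Matrix.conjTranspose_apply, Finset.mul_sum, Finset.sum_mul, star_mul', RCLike.star_def,
      Complex.conj_ofReal]
    exact Finset.sum_congr rfl fun i _ => Finset.sum_congr rfl fun j _ => by ring
  refine ⟨mixedUnitaryIsometry p U, ?_, fun X => ⟨?_, ?_⟩⟩
  · ext i j
    have h1 : ∀ s, ∑ a, star (U s a i) * U s a j = (1 : Matrix d d ℂ) i j := fun s => by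
      rw [← hU s]; rfl
    rw [Matrix.mul_apply, Fintype.sum_prod_type, Finset.sum_comm]
    have h2 : ∀ s a, (mixedUnitaryIsometry p U)ᴴ i (a, s) * mixedUnitaryIsometry p U (a, s) j =
        p s * (star (U s a i) * U s a j) := by
      intro s a
      rw [← hsq]
      simp only [mixedUnitaryIsometry, Matrix.of_apply, Matrix.conjTranspose_apply, star_mul',
        RCLike.star_def, Complex.conj_ofReal]
      ring
    simp only [h2, ← Finset.mul_sum, h1, ← Finset.sum_mul]
    rw [← Complex.ofReal_sum, hp1, Complex.ofReal_one, one_mul]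
  · ext a b
    simp only [hΦ, traceEnv, Matrix.of_apply, hV, hsq, Matrix.sum_apply, Matrix.smul_apply,
      smul_eq_mul]
  · ext s t
    simp only [mixedUnitaryComplement, LinearMap.coe_mk, AddHom.coe_mk, traceOut, Matrix.of_apply,
      hV, Matrix.trace, Matrix.diag_apply, Finset.mul_sum]

theorem isState_mix {d : Type*} [Fintype d] [DecidableEq d] {ψ : d → ℂ} (hψ : star ψ ⬝ᵥ ψ = 1)
    {ε : ℝ} (hε : 0 ≤ ε) (hε1 : ε ≤ 1) (hd : Fintype.card d ≠ 0) :
    IsState (((1 - ε : ℝ) : ℂ) • Matrix.vecMulVec ψ (star ψ) +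
      (ε : ℂ) • ((Fintype.card d : ℂ)⁻¹ • (1 : Matrix d d ℂ))) := by
  constructor
  · refine ((Matrix.posSemidef_vecMulVec_self_star ψ).smul ?_).add
      ((Matrix.PosSemidef.one.smul ?_).smul ?_)
    · exact_mod_cast sub_nonneg.2 hε1
    · exact inv_nonneg.2 (by exact_mod_cast Nat.zero_le _)
    · exact_mod_cast hε
  · have hd' : (Fintype.card d : ℂ) ≠ 0 := by exact_mod_cast hd
    rw [Matrix.trace_add, Matrix.trace_smul, Matrix.trace_smul, Matrix.trace_smul,
      Matrix.trace_vecMulVec, dotProduct_comm, hψ, Matrix.trace_one]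
    simp [hd']

/-- A channel complementary to a mixture of orthogonal unitary conjugations has a state of positive
coherent information, if for some pure state `ψ` the vectors `U s ψ` are proportional to the members
of an orthonormal basis, with each of them hit and one of them hit twice. -/
theorem exists_coherentInfo_pos {d S e : Type*} [Fintype d] [DecidableEq d] [Fintype S]
    [DecidableEq S] [Fintype e] [DecidableEq e] {Φ : Matrix d d ℂ →ₗ[ℂ] Matrix d d ℂ}
    {Ψ : Matrix d d ℂ →ₗ[ℂ] Matrix e e ℂ} (h : IsComplementary Φ Ψ) {p : S → ℝ}
    {U : S → Matrix d d ℂ} (hp : ∀ s, 0 < p s) (hp1 : ∑ s, p s = 1)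
    (hU : ∀ s, (U s)ᴴ * U s = 1) (hΦ : ∀ X, Φ X = ∑ s, (p s : ℂ) • (U s * X * (U s)ᴴ))
    (horth : ∀ s t, (U s * (U t)ᴴ).trace = if s = t then (Fintype.card d : ℂ) else 0)
    {W : Matrix d d ℂ} (hW : Wᴴ * W = 1) {ψ : d → ℂ} (hψ : star ψ ⬝ᵥ ψ = 1) {c : S → d}
    {z : S → ℂ} (hz : ∀ s, star (z s) * z s = 1) (hUψ : ∀ s, U s *ᵥ ψ = z s • W.col (c s))
    (hc : Function.Surjective c) (hc' : ¬ Function.Injective c) :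
    ∃ ρ : Matrix d d ℂ, IsState ρ ∧ 0 < coherentInfo Ψ ρ := by
  classical
  obtain ⟨s₀, t₀, hst, hne⟩ := Function.not_injective_iff.1 hc'
  have hcard : Fintype.card d ≠ 0 := (Fintype.card_pos_iff.2 ⟨c s₀⟩).ne'
  have hcard' : (Fintype.card d : ℂ) ≠ 0 := by exact_mod_cast hcard
  have hsq : ∀ s, (Real.sqrt (p s) : ℂ) * Real.sqrt (p s) = p s := fun s => by
    exact_mod_cast Real.mul_self_sqrt (hp s).le
  have hstar : ∀ x : ℝ, star (x : ℂ) = x := Complex.conj_ofReal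
  have hW' : W * Wᴴ = 1 := mul_eq_one_comm.1 hW
  -- `r` is the spectrum of `Φ(|ψ⟩⟨ψ|)` in the basis `W`, and `G * Gᴴ` is the complementary output
  -- at `ψ`. The columns of `G` are supported on the disjoint fibres of `c`. A fibre containing both
  -- `s₀` and `t₀` leaves room for a vector `k` orthogonal to every column.
  let r : d → ℝ := fun i => ∑ s, if c s = i then p s else 0
  let G : Matrix S d ℂ := Matrix.of fun s i => if c s = i then (Real.sqrt (p s) : ℂ) * z s else 0
  let k : S → ℂ := Pi.single s₀ (Real.sqrt (p t₀) * z s₀) - Pi.single t₀ (Real.sqrt (p s₀) * z t₀)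
  have hpr : ∀ s, p s ≤ r (c s) := by
    intro s
    have := Finset.single_le_sum (f := fun s' => if c s' = c s then p s' else 0)
      (fun s' _ => by split_ifs; exacts [(hp s').le, le_rfl]) (Finset.mem_univ s)
    simpa [r] using this
  have hr : ∀ i, 0 < r i := by
    intro i
    obtain ⟨s, rfl⟩ := hc i
    exact (hp s).trans_le (hpr s)
  have hrsum : ∀ f : d → ℂ, ∑ i, (r i : ℂ) * f i = ∑ s, (p s : ℂ) * f (c s) := by
    intro f
    simp only [r, Complex.ofReal_sum, Finset.sum_mul]
    rw [Finset.sum_comm]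
    refine Finset.sum_congr rfl fun s _ => ?_
    rw [Finset.sum_eq_single (c s)]
    · simp
    · intro i _ hi
      simp [hi.symm]
    · simp
  have hr1 : ∑ i, r i = 1 := by
    have := hrsum fun _ => 1
    simp only [mul_one] at this
    rw [← Complex.ofReal_sum, ← Complex.ofReal_sum, hp1] at this
    exact_mod_cast this
  have hp_le : ∀ s, p s ≤ 1 := fun s =>
    hp1 ▸ Finset.single_le_sum (fun s _ => (hp s).le) (Finset.mem_univ s)
  obtain ⟨b, hb, hbp⟩ : ∃ b, 0 < b ∧ ∀ s, b ≤ p s := by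
    obtain ⟨s, -, hs⟩ := Finset.exists_min_image Finset.univ p ⟨s₀, Finset.mem_univ _⟩
    exact ⟨p s, hp s, fun t => hs t (Finset.mem_univ t)⟩
  have hG : Gᴴ * G = Matrix.diagonal fun i => (r i : ℂ) := by
    ext i j
    rw [Matrix.mul_apply, Matrix.diagonal_apply]
    simp only [G, r, Matrix.conjTranspose_apply, Matrix.of_apply]
    split_ifs with hij
    · subst hij
      rw [Complex.ofReal_sum]
      refine Finset.sum_congr rfl fun s _ => ?_
      split_ifs
      · rw [← hsq, star_mul', hstar]
        linear_combination (Real.sqrt (p s) : ℂ) * Real.sqrt (p s) * hz s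
      · simp
    · refine Finset.sum_eq_zero fun s _ => ?_
      by_cases hi : c s = i
      · rw [if_neg (fun hj => hij (hi.symm.trans hj)), mul_zero]
      · rw [if_neg hi, star_zero, zero_mul]
  have hnz : ∀ s, Complex.normSq (z s) = 1 := fun s => by
    have := hz s
    rw [RCLike.star_def, ← Complex.normSq_eq_conj_mul_self] at this
    exact_mod_cast this
  -- On the fibre of `i`, `|G s i|² = p s ≤ r i`, and the `p s` there add up to `r i`.
  have hGp : ∀ i, ∑ s, p s * Complex.normSq (G s i) ≤ r i ^ 2 := by
    intro i
    rw [sq]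
    conv_rhs => rw [show r i = ∑ s, if c s = i then p s else 0 from rfl]
    rw [Finset.sum_mul]
    refine Finset.sum_le_sum fun s _ => ?_
    simp only [G, Matrix.of_apply]
    split_ifs with hi
    · rw [Complex.normSq_mul, hnz, Complex.normSq_ofReal, Real.mul_self_sqrt (hp s).le, mul_one]
      subst hi
      exact mul_le_mul_of_nonneg_left (hpr s) (hp s).le
    · simp
  have hk : k ≠ 0 := by
    intro h0
    have h1 := congrFun h0 s₀
    simp only [k, Pi.sub_apply, Pi.single_eq_same, Pi.single_eq_of_ne hne, sub_zero, Pi.zero_apply,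
      mul_eq_zero, Complex.ofReal_eq_zero] at h1
    rcases h1 with h1 | h1
    · exact (Real.sqrt_pos.2 (hp t₀)).ne' h1
    · have := hz s₀
      simp [h1] at this
  have hGk : Gᴴ *ᵥ k = 0 := by
    ext i
    simp only [k, Matrix.mulVec_sub, Matrix.mulVec_single, Pi.sub_apply, Pi.smul_apply,
      Matrix.col_apply, Matrix.conjTranspose_apply, G, Matrix.of_apply, hst, Pi.zero_apply,
      MulOpposite.smul_eq_mul_unop, MulOpposite.unop_op]
    split_ifs
    · rw [star_mul', star_mul', hstar, hstar]
      linear_combination (Real.sqrt (p s₀) : ℂ) * Real.sqrt (p t₀) * (hz s₀ - hz t₀)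
    · simp
  -- The constant is the slope in `ε` of the upper bound for the entropy of `Φ(ρ)`, apart from the
  -- common term `(1-ε) ∑ negMulLog (r i)`.
  obtain ⟨ε, hε, hε1, hlt⟩ :=
    exists_lt_mul_neg_log hb (∑ i, (Fintype.card d : ℝ)⁻¹ * -Real.log (r i))
  have hρ := isState_mix hψ hε.le hε1.le hcard
  refine ⟨_, hρ, ?_⟩
  have hcomp := isComplementary_mixedUnitaryComplement (fun s => (hp s).le) hp1 hU hΦ
  have hΨρ := hcomp.isState_right hρ
  rw [coherentInfo_eq h.symm hρ, h.entropy_eq hcomp hρ.1]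
  -- Orthogonality of the `U s` makes the complementary output of the maximally mixed state
  -- diagonal, with entries `p s`.
  have hΨ : mixedUnitaryComplement p U (((1 - ε : ℝ) : ℂ) • Matrix.vecMulVec ψ (star ψ) +
      (ε : ℂ) • ((Fintype.card d : ℂ)⁻¹ • (1 : Matrix d d ℂ))) =
      ((1 - ε : ℝ) : ℂ) • (G * Gᴴ) + (ε : ℂ) • Matrix.diagonal fun s => (p s : ℂ) := by
    rw [map_add, map_smul, map_smul, map_smul]
    congr 2
    · ext s t
      have hWc : W.col (c s) ⬝ᵥ star (W.col (c t)) = (1 : Matrix d d ℂ) (c t) (c s) := by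
        rw [← hW, dotProduct_comm]; rfl
      simp only [mixedUnitaryComplement, LinearMap.coe_mk, AddHom.coe_mk, Matrix.of_apply]
      rw [Matrix.mul_vecMulVec, Matrix.vecMulVec_mul, ← Matrix.star_mulVec, hUψ, hUψ,
        Matrix.trace_vecMulVec, star_smul, smul_dotProduct, dotProduct_smul, hWc,
        Matrix.mul_apply, Finset.sum_eq_single (c s)]
      · simp only [G, Matrix.of_apply, Matrix.conjTranspose_apply, Matrix.one_apply, if_true]
        split_ifs
        · simp only [smul_eq_mul, star_mul', hstar]
          ring
        · simp
      · intro i _ hi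
        simp [G, hi.symm]
      · simp
    · ext s t
      simp only [mixedUnitaryComplement, LinearMap.coe_mk, AddHom.coe_mk, Matrix.of_apply,
        Matrix.smul_apply, Matrix.mul_one, horth, Matrix.diagonal_apply, smul_eq_mul]
      split_ifs with hs
      · subst hs
        rw [hsq]
        field_simp
      · simp
  have hΦ' : Φ (((1 - ε : ℝ) : ℂ) • Matrix.vecMulVec ψ (star ψ) +
      (ε : ℂ) • ((Fintype.card d : ℂ)⁻¹ • (1 : Matrix d d ℂ))) =
      W * Matrix.diagonal (fun i => (((1 - ε) * r i + ε * (Fintype.card d : ℝ)⁻¹ : ℝ) : ℂ)) * Wᴴ := by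
    have h1 : Φ (Matrix.vecMulVec ψ (star ψ)) = W * Matrix.diagonal (fun i => (r i : ℂ)) * Wᴴ := by
      rw [hΦ]
      ext a b
      have e1 : ∀ s, U s * Matrix.vecMulVec ψ (star ψ) * (U s)ᴴ =
          Matrix.vecMulVec (W.col (c s)) (star (W.col (c s))) := by
        intro s
        rw [Matrix.mul_vecMulVec, Matrix.vecMulVec_mul, ← Matrix.star_mulVec, hUψ]
        ext a b
        simp only [Matrix.vecMulVec_apply, Pi.smul_apply, Pi.star_apply, smul_eq_mul, star_mul']
        linear_combination (W.col (c s) a * star (W.col (c s) b)) * hz s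
      have e2 := hrsum fun i => W a i * star (W b i)
      rw [Matrix.mul_apply]
      simp only [e1, Matrix.sum_apply, Matrix.smul_apply, Matrix.vecMulVec_apply, Matrix.col_apply,
        Pi.star_apply, smul_eq_mul, Matrix.mul_diagonal, Matrix.conjTranspose_apply]
      rw [← e2]
      exact Finset.sum_congr rfl fun i _ => by ring
    have h2 : Φ 1 = 1 := by
      have hU' : ∀ s, U s * (U s)ᴴ = 1 := fun s => mul_eq_one_comm.1 (hU s)
      rw [hΦ]
      simp only [Matrix.mul_one, hU', ← Finset.sum_smul]
      rw [← Complex.ofReal_sum, hp1, Complex.ofReal_one, one_smul]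
    have h3 : Matrix.diagonal (fun i => (((1 - ε) * r i + ε * (Fintype.card d : ℝ)⁻¹ : ℝ) : ℂ)) =
        ((1 - ε : ℝ) : ℂ) • Matrix.diagonal (fun i => (r i : ℂ)) +
          (ε : ℂ) • ((Fintype.card d : ℂ)⁻¹ • (1 : Matrix d d ℂ)) := by
      ext i j
      by_cases hij : i = j
      · subst hij; simp
      · simp [hij]
    rw [map_add, map_smul, map_smul, map_smul, h1, h2, h3]
    simp only [Matrix.mul_add, Matrix.add_mul, Matrix.mul_smul, Matrix.smul_mul, Matrix.mul_one,
      hW']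
  rw [hΨ] at hΨρ ⊢
  rw [hΦ']
  have lower := le_entropy_add_diagonal hb hbp hp_le hr hG hGp hk hGk hε hε1 hΨρ
  have upper := entropy_conj_diagonal_mix_le hW hr hr1
    (u := fun _ => (Fintype.card d : ℝ)⁻¹) (fun _ => by positivity)
    (by simp [hcard]) hε.le hε1.le
  -- The unperturbed entropies cancel between `lower` and `upper`; only the terms of weight `ε` are
  -- compared.
  have := mul_lt_mul_of_pos_left hlt hε
  linarith

/-! The Heisenberg–Weyl operators -/

theorem star_inv_sqrt (d : ℕ) : star (Real.sqrt d : ℂ)⁻¹ = (Real.sqrt d : ℂ)⁻¹ := by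
  rw [← Complex.ofReal_inv]
  exact Complex.conj_ofReal _

section

variable (d : ℕ)

/-- The root of unity `exp (2 π i / d)`. -/
noncomputable def weylRoot : ℂ := Complex.exp (2 * Real.pi * Complex.I / d)

variable [NeZero d]

theorem weylRoot_isPrimitiveRoot : IsPrimitiveRoot (weylRoot d) d :=
  Complex.isPrimitiveRoot_exp d (NeZero.ne d)

theorem star_weylRoot_mul : star (weylRoot d) * weylRoot d = 1 := by
  have h : ‖weylRoot d‖ = 1 := (weylRoot_isPrimitiveRoot d).norm'_eq_one (NeZero.ne d)
  rw [RCLike.star_def, Complex.conj_mul', h]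
  simp

theorem star_weylRoot_pow_mul (n : ℕ) : star (weylRoot d ^ n) * weylRoot d ^ n = 1 := by
  rw [star_pow, ← mul_pow, star_weylRoot_mul, one_pow]

/-- Addition in `Fin d` wraps around, which `ω ^ d = 1` does not see. -/
theorem weylRoot_pow_add (a b j : Fin d) :
    weylRoot d ^ (((a + b : Fin d) : ℕ) * (j : ℕ)) =
      weylRoot d ^ ((a : ℕ) * (j : ℕ)) * weylRoot d ^ ((b : ℕ) * (j : ℕ)) := by
  rw [← pow_add, ← add_mul, pow_mul, pow_mul, Fin.val_add]
  congr 1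
  conv_rhs => rw [← Nat.div_add_mod (a + b) d, pow_add, pow_mul,
    (weylRoot_isPrimitiveRoot d).pow_eq_one, one_pow, one_mul]

theorem sum_weylRoot_pow (j l : Fin d) :
    ∑ b : Fin d, weylRoot d ^ ((b : ℕ) * (j : ℕ)) * star (weylRoot d ^ ((b : ℕ) * (l : ℕ))) =
      if j = l then (d : ℂ) else 0 := by
  have hω := weylRoot_isPrimitiveRoot d
  have hs := star_weylRoot_pow_mul d
  split_ifs with hjl
  · subst hjl
    simp only [mul_comm (weylRoot d ^ _), hs]
    simp
  -- `x` is `ω ^ (j - l)`, with conjugation as inverse to avoid subtracting exponents; the sum is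
  -- geometric with ratio a root of unity `x ≠ 1`.
  · obtain ⟨x, hx⟩ : ∃ x, x = weylRoot d ^ (j : ℕ) * star (weylRoot d ^ (l : ℕ)) := ⟨_, rfl⟩
    have hx1 : x ≠ 1 := by
      intro h1
      apply hjl
      refine Fin.ext (hω.pow_inj j.2 l.2 ?_)
      have := congrArg (· * weylRoot d ^ (l : ℕ)) (hx.symm.trans h1)
      simpa only [mul_assoc, hs, mul_one, one_mul] using this
    have hxd : x ^ d = 1 := by
      rw [hx, mul_pow, ← star_pow, ← pow_mul, ← pow_mul, mul_comm, mul_comm _ d, mul_comm _ d,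
        pow_mul, pow_mul, hω.pow_eq_one]
      simp
    have e : ∀ b : Fin d,
        weylRoot d ^ ((b : ℕ) * (j : ℕ)) * star (weylRoot d ^ ((b : ℕ) * (l : ℕ))) = x ^ (b : ℕ) := by
      intro b
      rw [hx, mul_pow, ← star_pow, ← pow_mul, ← pow_mul, mul_comm (b : ℕ), mul_comm (b : ℕ)]
    simp only [e]
    rw [Fin.sum_univ_eq_sum_range (fun n => x ^ n) d]
    have := mul_neg_geom_sum x d
    rw [hxd, sub_self] at this
    exact (mul_eq_zero.1 this).resolve_left (sub_ne_zero.2 hx1.symm)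

theorem shift_pow_apply (n : ℕ) (a b : Fin d) :
    (shift d ^ n) a b = if (a : ℕ) = ((b : ℕ) + n) % d then 1 else 0 := by
  induction n generalizing a with
  | zero => simp [Matrix.one_apply, Fin.ext_iff, Nat.mod_eq_of_lt b.2]
  | succ n ih =>
    rw [pow_succ', Matrix.mul_apply,
      Finset.sum_eq_single ⟨((b : ℕ) + n) % d, Nat.mod_lt _ (NeZero.pos d)⟩]
    · rw [ih]
      simp [shift, add_assoc]
    · intro c _ hc
      rw [ih, if_neg (fun h => hc (Fin.ext h)), mul_zero]
    · simp

theorem weyl_apply (i j a b : Fin d) :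
    weyl d i j a b = if a = b + i then weylRoot d ^ ((b : ℕ) * (j : ℕ)) else 0 := by
  rw [weyl, clock, Matrix.diagonal_pow, Matrix.mul_diagonal, shift_pow_apply]
  simp only [Fin.ext_iff, Fin.val_add, Pi.pow_apply, ← pow_mul, weylRoot]
  split_ifs <;> simp

theorem trace_weyl_mul (i j k l : Fin d) :
    (weyl d i j * (weyl d k l)ᴴ).trace = if i = k ∧ j = l then (d : ℂ) else 0 := by
  have h : (weyl d i j * (weyl d k l)ᴴ).trace = ∑ b : Fin d, if i = k then
      weylRoot d ^ ((b : ℕ) * (j : ℕ)) * star (weylRoot d ^ ((b : ℕ) * (l : ℕ))) else 0 := by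
    simp only [Matrix.trace, Matrix.diag_apply, Matrix.mul_apply, Matrix.conjTranspose_apply,
      weyl_apply]
    rw [Finset.sum_comm]
    refine Finset.sum_congr rfl fun b _ => ?_
    rw [Finset.sum_eq_single (b + i)]
    · simp only [if_true, add_right_inj]
      split_ifs <;> simp
    · intro a _ ha
      simp [ha]
    · simp
  rw [h]
  by_cases hik : i = k
  · simp only [hik, if_true, true_and]
    exact sum_weylRoot_pow d j l
  · simp [hik]

theorem weyl_conjTranspose_mul (i j : Fin d) : (weyl d i j)ᴴ * weyl d i j = 1 := by
  ext a b
  rw [Matrix.mul_apply, Finset.sum_eq_single (a + i)]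
  · simp only [Matrix.conjTranspose_apply, weyl_apply, if_true, add_left_inj, Matrix.one_apply]
    split_ifs with h
    · rw [h, star_weylRoot_pow_mul]
    · simp
  · intro c _ hc
    simp [weyl_apply, hc]
  · simp

/-- `|0⟩` is fixed by the clock matrix, so only the row index survives. -/
theorem weyl_mulVec_single (i j : Fin d) :
    weyl d i j *ᵥ Pi.single 0 1 = (1 : Matrix (Fin d) (Fin d) ℂ).col i := by
  ext a
  rw [Matrix.mulVec_single_one, Matrix.col_apply, weyl_apply]
  simp [Matrix.one_apply]

/-- The unitary matrix of the discrete Fourier transform. -/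
noncomputable def fourier : Matrix (Fin d) (Fin d) ℂ :=
  Matrix.of fun a j => (Real.sqrt d : ℂ)⁻¹ * weylRoot d ^ ((a : ℕ) * (j : ℕ))

theorem inv_sqrt_mul_self : (Real.sqrt d : ℂ)⁻¹ * (Real.sqrt d : ℂ)⁻¹ * d = 1 := by
  have h : (Real.sqrt d : ℂ) * Real.sqrt d = d := by
    exact_mod_cast Real.mul_self_sqrt (Nat.cast_nonneg d)
  have hd : (d : ℂ) ≠ 0 := by exact_mod_cast NeZero.ne d
  rw [← mul_inv, h, inv_mul_cancel₀ hd]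

theorem fourier_conjTranspose_mul : (fourier d)ᴴ * fourier d = 1 := by
  ext j l
  have e : ∀ a, (fourier d)ᴴ j a * fourier d a l = (Real.sqrt d : ℂ)⁻¹ * (Real.sqrt d : ℂ)⁻¹ *
      (weylRoot d ^ ((a : ℕ) * (l : ℕ)) * star (weylRoot d ^ ((a : ℕ) * (j : ℕ)))) := by
    intro a
    simp only [fourier, Matrix.conjTranspose_apply, Matrix.of_apply, star_mul', star_inv_sqrt]
    ring
  rw [Matrix.mul_apply]
  simp only [e]
  rw [← Finset.mul_sum, sum_weylRoot_pow, Matrix.one_apply]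
  by_cases h : j = l
  · rw [if_pos h.symm, if_pos h, inv_sqrt_mul_self]
  · rw [if_neg (Ne.symm h), if_neg h, mul_zero]

/-- The clock power turns the uniform vector into the `j`-th Fourier vector. That is an eigenvector
of the shift, so the row index enters only through a phase. -/
theorem weyl_mulVec_const (i j : Fin d) :
    weyl d i j *ᵥ (fun _ => (Real.sqrt d : ℂ)⁻¹) =
      star (weylRoot d ^ ((i : ℕ) * (j : ℕ))) • (fourier d).col j := by
  ext a
  obtain ⟨b, rfl⟩ : ∃ b, a = b + i := ⟨a - i, by simp⟩
  rw [Matrix.mulVec, dotProduct, Finset.sum_eq_single b]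
  · simp only [weyl_apply, if_true, Pi.smul_apply, Matrix.col_apply, fourier, Matrix.of_apply,
      weylRoot_pow_add, smul_eq_mul]
    linear_combination (-(Real.sqrt d : ℂ)⁻¹ * weylRoot d ^ ((b : ℕ) * (j : ℕ))) *
      star_weylRoot_pow_mul d ((i : ℕ) * (j : ℕ))
  · intro c _ hc
    simp [weyl_apply, hc.symm]
  · simp

end

/-! ### Choice of the pure state for a generalized Pauli channel. -/

theorem exists_coherentInfo_pauliChannel_pos {d : ℕ} [NeZero d] {P : Matrix (Fin d) (Fin d) ℝ}
    (hP_nonneg : ∀ i j, 0 ≤ P i j) (hP_sum : ∑ i, ∑ j, P i j = 1)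
    (hP_card : d + 1 ≤ {ij : Fin d × Fin d | P ij.1 ij.2 ≠ 0}.ncard)
    (hP_supp : (∀ i, ∃ j, P i j ≠ 0) ∨ (∀ j, ∃ i, P i j ≠ 0))
    {m : ℕ} {Ψ : Matrix (Fin d) (Fin d) ℂ →ₗ[ℂ] Matrix (Fin m) (Fin m) ℂ}
    (hΨ : IsComplementary (pauliChannel P) Ψ) :
    ∃ ρ : Matrix (Fin d) (Fin d) ℂ, IsState ρ ∧ 0 < coherentInfo Ψ ρ := by
  classical
  -- Restricting to the support of `P` makes all weights positive and the complementary output as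
  -- small as possible.
  let S := {ij : Fin d × Fin d // P ij.1 ij.2 ≠ 0}
  have hsum : ∀ {M : Type} [AddCommMonoid M] (f : Fin d × Fin d → M),
      (∀ ij, P ij.1 ij.2 = 0 → f ij = 0) → ∑ s : S, f s = ∑ ij, f ij := by
    intro M _ f hf
    rw [← Finset.sum_filter_of_ne (p := fun ij => P ij.1 ij.2 ≠ 0) fun ij _ h h0 => h (hf ij h0)]
    exact (Finset.sum_subtype _ (by simp) f).symm
  have hp : ∀ s : S, 0 < P s.1.1 s.1.2 := fun s => (hP_nonneg _ _).lt_of_ne' s.2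
  have hp1 : ∑ s : S, P s.1.1 s.1.2 = 1 := by
    rw [hsum (fun ij => P ij.1 ij.2) fun _ h => h, Fintype.sum_prod_type, hP_sum]
  have hΦ : ∀ X, pauliChannel P X =
      ∑ s : S, (P s.1.1 s.1.2 : ℂ) • (weyl d s.1.1 s.1.2 * X * (weyl d s.1.1 s.1.2)ᴴ) := by
    intro X
    rw [hsum (fun ij => (P ij.1 ij.2 : ℂ) • (weyl d ij.1 ij.2 * X * (weyl d ij.1 ij.2)ᴴ))
      fun _ h => by simp [h], Fintype.sum_prod_type]
    simp [pauliChannel, LinearMap.sum_apply]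
  have horth : ∀ s t : S, (weyl d s.1.1 s.1.2 * (weyl d t.1.1 t.1.2)ᴴ).trace =
      if s = t then (Fintype.card (Fin d) : ℂ) else 0 := by
    intro s t
    rw [trace_weyl_mul, Fintype.card_fin]
    exact if_congr (by rw [Subtype.ext_iff, Prod.ext_iff]) rfl rfl
  -- Pigeonhole: the support has at least `d + 1` elements.
  have hinj : ∀ c : S → Fin d, ¬ Function.Injective c := by
    intro c hc
    have h1 := Nat.card_le_card_of_injective c hc
    rw [Nat.card_eq_fintype_card (α := Fin d), Fintype.card_fin] at h1
    have h2 : Nat.card S = {ij : Fin d × Fin d | P ij.1 ij.2 ≠ 0}.ncard :=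
      Nat.card_coe_set_eq {ij : Fin d × Fin d | P ij.1 ij.2 ≠ 0}
    omega
  rcases hP_supp with h | h
  -- Nonzero rows: the orbit of `|0⟩` covers the standard basis, indexed by rows.
  · refine exists_coherentInfo_pos hΨ hp hp1 (fun s => weyl_conjTranspose_mul d _ _) hΦ horth
      (W := 1) (ψ := Pi.single 0 1) (c := fun s => s.1.1) (z := fun _ => 1) (by simp) (by simp)
      (by simp) (fun s => ?_) (fun i => ?_) (hinj _)
    · rw [weyl_mulVec_single, one_smul]
    · obtain ⟨j, hj⟩ := h i
      exact ⟨⟨(i, j), hj⟩, rfl⟩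
  -- Nonzero columns: the orbit of the uniform vector covers the Fourier basis, indexed by columns.
  · refine exists_coherentInfo_pos hΨ hp hp1 (fun s => weyl_conjTranspose_mul d _ _) hΦ horth
      (fourier_conjTranspose_mul d) (ψ := fun _ => (Real.sqrt d : ℂ)⁻¹) (c := fun s => s.1.2)
      (z := fun s => star (weylRoot d ^ ((s.1.1 : ℕ) * (s.1.2 : ℕ)))) ?_ (fun s => ?_)
      (fun s => weyl_mulVec_const d _ _) (fun j => ?_) (hinj _)
    · simp only [dotProduct, Pi.star_apply, star_inv_sqrt, Finset.sum_const, Finset.card_univ,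
        Fintype.card_fin, nsmul_eq_mul]
      rw [mul_comm, inv_sqrt_mul_self]
    · rw [star_star, mul_comm, star_weylRoot_pow_mul]
    · obtain ⟨i, hi⟩ := h j
      exact ⟨⟨(i, j), hi⟩, rfl⟩

end QChannel

theorem theorem4p4 {d : ℕ} (P : Matrix (Fin d) (Fin d) ℝ)
    (hP_nonneg : ∀ i j, 0 ≤ P i j) (hP_sum : ∑ i, ∑ j, P i j = 1)
    (hP_card : d + 1 ≤ {ij : Fin d × Fin d | P ij.1 ij.2 ≠ 0}.ncard)
    (hP_supp : (∀ i, ∃ j, P i j ≠ 0) ∨ (∀ j, ∃ i, P i j ≠ 0))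
    {m : ℕ} (Ψ : Matrix (Fin d) (Fin d) ℂ →ₗ[ℂ] Matrix (Fin m) (Fin m) ℂ)
    (hΨ : QChannel.IsComplementary (QChannel.pauliChannel P) Ψ) :
    ∃ q : ℝ, QChannel.HasQuantumCapacity Ψ q ∧ 0 < q := by
  -- For `d = 0` the entries of `P` would sum to `0`.
  have : NeZero d := ⟨by rintro rfl; simp at hP_sum⟩
  obtain ⟨ρ, hρ, hpos⟩ :=
    QChannel.exists_coherentInfo_pauliChannel_pos hP_nonneg hP_sum hP_card hP_supp hΨ
  obtain ⟨q, hq, hle⟩ := hΨ.symm.exists_hasQuantumCapacity hρ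
  exact ⟨q, hq, hpos.trans_le hle⟩
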